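/- **Conventions.** Let $G$ be an ordered (i.e. totally ordered) abelian group and $\psi : G\setminus\{0\}\to G$ a map. The pair $(G,\psi)$ is an *H-type asymptotic couple* if, for all nonzero $g,h\in G$: $\psi(g+h)\ge\min(\psi(g),\psi(h))$ whenever $g+h\neq 0$; $\psi(ng)=\psi(g)$ for all $n\in\mathbb Z\setminus\{0\}$; $\psi(g)<\psi(h)+|h|$; and $g\le h<0$ implies $\psi(g)\le\psi(h)$. Put $\psi(0)=\infty$ and $\Psi=\psi(G\setminus\{0\})$. For $\lambda\in\Psi$ let $G^{\lambda}=\{g:\psi(g)\ge\lambda\}$, $G_{\lambda}=\{g:\psi(g)>\lambda\}$ and $B_\lambda=G^\lambda/G_\lambda$, with the order induced from $G$ ($G_\lambda$ is convex); let $\widehat B_\lambda$ be the divisible hull of $B_\lambda$. For a field $k$, let $K=k((G))$ be the field of generalized power series $a=\sum_{g\in G}a_gt^g$ with well-ordered support and $v(a)=\min\operatorname{supp}(a)$, $v(0)=\infty$; if $k$ is ordered, $K$ is ordered by: $a<b$ iff $b-a$ has positive leading coefficient. For a derivation $D$ on $K$ with field of constants $C$, put $\mathcal O=\{a : v(a)\ge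 0\}$ and $\mathfrak m=\{a: v(a)>0\}$. Then $(K,v,D)$ is a *differential-valued field* if $\mathcal O=\mathfrak m+C$ and $v(D(a))>v(D(b)/b)$ for all $a\in\mathcal O$ and $0\ne b\in\mathfrak m$. It is an *H-field* (for $k$ ordered) if it is differential-valued, $\mathcal O$ is convex, $\mathcal O=\{a : |a|\le c\text{ for some }c\in C\}$, and $D(a)>0$ for every $a>\mathcal O$. It *has asymptotic couple $(G,\psi)$* if $v(D(a)/a)=\psi(v(a))$ for all $a\in K\setminus\{0\}$ with $v(a)\ne0$. A *Hahn embedding* of $(G,\psi)$ is a group homomorphism $\iota: G\to\prod_{\lambda\in\Psi}\widehat B_\lambda$, $g\mapsto(g_\lambda)_{\lambda\in\Psi}$, such that every $\operatorname{supp}(g)=\{\lambda: g_\lambda\ne0\}$ is well-ordered, $\min\operatorname{supp}(g)=\psi(g)$ for $g\neq0$, and $g_\lambda$ is the class of $g$ in $B_\lambda\subseteq\widehat B_\lambda$ for all $\lambda\in\Psi$ and $g\in G^\lambda$. **Theorem.** Let $k$ be a field (respectively, an ordered field) and $(G,\psi)$ an H-type asymptotic couple. There is a derivation $D$ on $K=k((G))$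 making $(K,v,D)$ a differential-valued field (respectively, an H-field) with asymptotic couple $(G,\psi)$ if and only if, for every $\lambda\in\Psi$, $B_\lambda$ embeds as a group into $(k,+)$ (respectively, as an ordered group into $(k,+,\le)$). In that case $D$ can be given explicitly. Namely, let $(u_\lambda:B_\lambda\to k)_{\lambda\in\Psi}$ be any family of group embeddings (respectively, order-reversing group embeddings). Then a Hahn embedding of $(G,\psi)$ exists, the $u_\lambda$ extend to group homomorphisms $u_\lambda:\widehat B_\lambda\to k$, and for every Hahn embedding $g\mapsto (g_\lambda)_{\lambda\in\Psi}$ of $(G,\psi)$ the formula $$D\Big(\sum_{g\in G}a_gt^g\Big)=\sum_{0\ne g\in G}\ \sum_{\lambda\in\Psi}a_g\,u_\lambda(g_\lambda)\,t^{g+\lambda}\qquad(\dagger)$$ (whose right-hand side is a summable family: the union of the supports is well-ordered and each exponent occurs in finitely many nonzero terms) defines a derivation $D$ on $K$ making $(K,v,D)$ a differential-valued field (respectively, an H-field) with asymptotic couple $(G,\psi)$. -/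

import Mathlib

open HahnSeries

noncomputable section

/-! ### Valued groups, skeletons and Hahn products -/

/-- A valuation `w : G → Γ ∪ {∞}` on an abelian group `G`, with values in a chain `Γ`. -/
structure GroupValuation (G Γ : Type*) [AddCommGroup G] [LinearOrder Γ] where
  toFun : G → WithTop Γ
  eq_top_iff' : ∀ g, toFun g = ⊤ ↔ g = 0
  map_neg' : ∀ g, toFun (-g) = toFun g
  map_add' : ∀ g h, min (toFun g) (toFun h) ≤ toFun (g + h)

namespace GroupValuation

variable {G Γ : Type*} [AddCommGroup G] [LinearOrder Γ]

/-- The subgroup `G^γ = {g | w g ≥ γ}`. -/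
def upper (w : GroupValuation G Γ) (γ : Γ) : AddSubgroup G where
  carrier := {g | (γ : WithTop Γ) ≤ w.toFun g}
  zero_mem' := by
    have h : w.toFun 0 = ⊤ := (w.eq_top_iff' 0).2 rfl
    simp [h]
  add_mem' := fun {a b} ha hb => le_trans (le_min ha hb) (w.map_add' a b)
  neg_mem' := fun {a} ha => by
    change (γ : WithTop Γ) ≤ w.toFun (-a)
    rw [w.map_neg']
    exact ha

/-- The subgroup `G_γ = {g | w g > γ}`. -/
def lower (w : GroupValuation G Γ) (γ : Γ) : AddSubgroup G where
  carrier := {g | (γ : WithTop Γ) < w.toFun g}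
  zero_mem' := by
    have h : w.toFun 0 = ⊤ := (w.eq_top_iff' 0).2 rfl
    simp [h]
  add_mem' := fun {a b} ha hb => lt_of_lt_of_le (lt_min ha hb) (w.map_add' a b)
  neg_mem' := fun {a} ha => by
    change (γ : WithTop Γ) < w.toFun (-a)
    rw [w.map_neg']
    exact ha

/-- The component `B_γ = G^γ / G_γ` of the valued group `(G, w)`. -/
abbrev Component (w : GroupValuation G Γ) (γ : Γ) : Type _ :=
  w.upper γ ⧸ (w.lower γ).addSubgroupOf (w.upper γ)

/-- The class in `B_γ` of an element of `G^γ`. -/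
def toComponent (w : GroupValuation G Γ) (γ : Γ) : w.upper γ →+ w.Component γ :=
  QuotientAddGroup.mk' _

/-- The order induced on `B_γ` by an order of `G` (for which `G_γ` is convex): one class is below
another when some representative of the first is below some representative of the second. -/
def componentLE [LE G] (w : GroupValuation G Γ) (γ : Γ) (x y : w.Component γ) : Prop :=
  ∃ g h : w.upper γ, w.toComponent γ g = x ∧ w.toComponent γ h = y ∧ (g : G) ≤ (h : G)

end GroupValuation

/-- The Hahn product of a family of groups: families with well-ordered support. -/
def hahnProduct {Γ : Type*} [LinearOrder Γ] (B : Γ → Type*) [∀ γ, AddCommGroup (B γ)] :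
    AddSubgroup (∀ γ, B γ) where
  carrier := {f | {γ | f γ ≠ 0}.IsWF}
  zero_mem' := by simp
  add_mem' := fun {a b} ha hb => by
    refine (Set.IsWF.union ha hb).mono ?_
    intro γ hγ
    by_contra hcon
    simp only [Set.mem_union, Set.mem_ofPred_eq, not_or, not_not] at hcon
    exact hγ (by simp [hcon.1, hcon.2])
  neg_mem' := fun {a} ha => by
    change {γ | (-a) γ ≠ 0}.IsWF
    simpa using ha

/-- `ι` is a Hahn embedding of the valued group `(G, w)` into the Hahn product of the divisible
hulls of its components: it preserves the valuation (that of the Hahn product being the minimum of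
the support), and it is the canonical map on the components. -/
structure IsHahnEmbedding {G Γ : Type*} [AddCommGroup G] [LinearOrder Γ] (w : GroupValuation G Γ)
    (ι : G →+ hahnProduct (fun γ => DivisibleHull (w.Component γ))) : Prop where
  isLeast_support : ∀ (g : G) (γ : Γ), w.toFun g = γ →
    IsLeast {δ | (ι g : ∀ γ, DivisibleHull (w.Component γ)) δ ≠ 0} γ
  apply_upper : ∀ (γ : Γ) (g : w.upper γ),
    (ι g : ∀ γ, DivisibleHull (w.Component γ)) γ = DivisibleHull.coe (w.toComponent γ g)

/-! ### Asymptotic couples -/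

/-- Asymptotic couples `(G, ψ)`, where `ψ` is defined on the nonzero elements of `G`. -/
structure IsAsymptoticCouple {G : Type*} [AddCommGroup G] [LinearOrder G]
    (ψ : {g : G // g ≠ 0} → G) : Prop where
  ac1 : ∀ (g h : {g : G // g ≠ 0}) (hgh : (g : G) + h ≠ 0),
    min (ψ g) (ψ h) ≤ ψ ⟨g + h, hgh⟩
  ac2 : ∀ (n : ℤ) (g : {g : G // g ≠ 0}) (hng : n • (g : G) ≠ 0), ψ ⟨n • (g : G), hng⟩ = ψ g
  ac3 : ∀ g h : {g : G // g ≠ 0}, ψ g < ψ h + |(h : G)|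

/-- Asymptotic couples of H-type. -/
structure IsHTypeAsymptoticCouple {G : Type*} [AddCommGroup G] [LinearOrder G]
    (ψ : {g : G // g ≠ 0} → G) : Prop extends IsAsymptoticCouple ψ where
  ach : ∀ g h : {g : G // g ≠ 0}, (g : G) ≤ h → (h : G) < 0 → ψ g ≤ ψ h

open Classical in
/-- The map `ψ` of an asymptotic couple, extended by `ψ 0 = ∞`, as a valuation of the group `G`
with value chain `Ψ = ψ (G ∖ {0})`. -/
def psiValuation {G : Type*} [AddCommGroup G] [LinearOrder G]
    {ψ : {g : G // g ≠ 0} → G} (hψ : IsAsymptoticCouple ψ) :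
    GroupValuation G (Set.range ψ) where
  toFun g := if hg : g = 0 then ⊤ else ((⟨ψ ⟨g, hg⟩, ⟨g, hg⟩, rfl⟩ : Set.range ψ) : WithTop _)
  eq_top_iff' g := by
    by_cases hg : g = 0 <;> simp [hg]
  map_neg' g := by
    by_cases hg : g = 0
    · simp [hg]
    · have h1 := hψ.ac2 (-1) ⟨g, hg⟩ (by simpa using hg)
      simp only [neg_smul, one_smul] at h1
      simp [hg, h1]
  map_add' g h := by
    by_cases hg : g = 0
    · simp [hg]
    · by_cases hh : h = 0
      · simp [hh]
      · by_cases hgh : g + h = 0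
        · simp [hgh]
        · have h1 := hψ.ac1 ⟨g, hg⟩ ⟨h, hh⟩ hgh
          simp only [hg, hh, hgh, dite_false]
          rw [← WithTop.coe_min, WithTop.coe_le_coe]
          rcases min_le_iff.1 h1 with h2 | h2
          · exact min_le_of_left_le h2
          · exact min_le_of_right_le h2

/-! ### Differential-valued fields and H-fields -/

section Fields

variable {K Γ : Type*} [Field K] [AddCommGroup Γ] [LinearOrder Γ] [IsOrderedAddMonoid Γ]

/-- Pre-differential-valued fields: if `v a ≥ 0`, `v b > 0` and `b ≠ 0`, then
`v (D a) > v (D b / b)`. -/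
structure IsPreDifferentialValued (v : AddValuation K (WithTop Γ)) (D : Derivation ℤ K K) :
    Prop where
  dv2 : ∀ a b : K, 0 ≤ v a → 0 < v b → b ≠ 0 → v (D b / b) < v (D a)

/-- Differential-valued fields: moreover, the valuation ring is the sum of its maximal ideal and
the field of constants. -/
structure IsDifferentialValued (v : AddValuation K (WithTop Γ)) (D : Derivation ℤ K K) : Prop
    extends IsPreDifferentialValued v D where
  dv1 : ∀ a : K, 0 ≤ v a ↔ ∃ ε c : K, 0 < v ε ∧ D c = 0 ∧ a = ε + c

/-- The asymptotic couple of `(K, v, D)` is `(Γ, ψ)`: the valuation takes all values in `Γ`, and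
`ψ (v a) = v (D a / a)` for all `a ≠ 0` with `v a ≠ 0`. -/
def HasAsymptoticCouple (v : AddValuation K (WithTop Γ)) (D : Derivation ℤ K K)
    (ψ : {g : Γ // g ≠ 0} → Γ) : Prop :=
  Function.Surjective v ∧
    ∀ (g : {g : Γ // g ≠ 0}) (a : K), v a = (g : Γ) → v (D a / a) = (ψ g : Γ)

variable [LinearOrder K]

/-- Pre-H-fields. -/
structure IsPreHField (v : AddValuation K (WithTop Γ)) (D : Derivation ℤ K K) : Prop
    extends IsPreDifferentialValued v D where
  ph2 : {a : K | 0 ≤ v a}.OrdConnected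
  ph3 : ∀ a : K, (∀ b : K, 0 ≤ v b → b < a) → 0 < D a

/-- `(K, ≤, D)` is an H-field, `v` being the valuation whose valuation ring is the convex hull
`{a | ∃ c, D c = 0 ∧ |a| ≤ c}` of the field of constants. -/
structure IsHField (v : AddValuation K (WithTop Γ)) (D : Derivation ℤ K K) : Prop
    extends IsPreHField v D where
  h1 : ∀ a : K, 0 ≤ v a ↔ ∃ c : K, D c = 0 ∧ |a| ≤ c
  h2 : ∀ a : K, 0 ≤ v a ↔ ∃ c ε : K, D c = 0 ∧ 0 < v ε ∧ a = c + ε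

end Fields

/-! ### Power series -/

/-- The usual valuation `v a = min (supp a)` of `k((G))`, the latter being equipped with its
order (`a < b` iff the leading coefficient of `b - a` is positive). -/
def lexAddVal (G k : Type*) [AddCommGroup G] [LinearOrder G] [IsOrderedAddMonoid G] [Field k] :
    AddValuation (Lex k⟦G⟧) (WithTop G) :=
  (addVal G k).comap
    { toFun := ofLex, map_one' := rfl, map_mul' := fun _ _ => rfl, map_zero' := rfl,
      map_add' := fun _ _ => rfl }

/-- The map `D` on `k((G))` is given by the formula
`D (∑ a_g t^g) = ∑_{g ≠ 0} ∑_{λ ∈ Ψ} a_g u_λ(g_λ) t^(g + λ)`,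
where `g_λ` is the component at `λ` of the image of `g` under `ι`; the family on the right is
required to be summable. -/
def IsGivenByFormula {G k : Type*} [AddCommGroup G] [LinearOrder G]
    [IsOrderedAddMonoid G] [Field k] {ψ : {g : G // g ≠ 0} → G} (hψ : IsAsymptoticCouple ψ)
    (ι : G →+ hahnProduct (fun l => DivisibleHull ((psiValuation hψ).Component l)))
    (u : ∀ l, DivisibleHull ((psiValuation hψ).Component l) →+ k) (D : k⟦G⟧ → k⟦G⟧) : Prop :=
  ∀ a : k⟦G⟧, ∃ s : SummableFamily G k ({g : G // g ≠ 0} × Set.range ψ),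
    (∀ p, s p = single ((p.1 : G) + (p.2 : G))
      (a.coeff p.1 *
        u p.2 ((ι p.1 : ∀ l, DivisibleHull ((psiValuation hψ).Component l)) p.2))) ∧
    D a = s.hsum

end

/-! ### Asymptotic couples -/

section AsymptoticCouple

variable {G : Type*} [AddCommGroup G] [LinearOrder G] {ψ : {g : G // g ≠ 0} → G}

/-! Necessity comes from the logarithmic derivative. The map g ↦ D(t^g)/t^g is additive and takes g
≠ 0 to a series of valuation ψ(g), so on G^λ its coefficient at λ is a homomorphism to k with kernel
exactly G_λ. In an H-field, t^(-g) with g > 0 exceeds the valuation ring, so its derivative is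
positive; hence this homomorphism reverses the order, and its negative preserves it.

For sufficiency, any additive χ : G → k gives a derivation t^g ↦ χ(g) t^g. With χ_λ(g) = u_λ(g_λ),
formula (†) is the sum over λ of these derivations multiplied by t^λ, and so is a derivation once
the sum exists. Summability is the crux (`IsPsiFamily.not_antitone`). It rests on λ < ψ(μ - λ) for λ
< μ in Ψ (`lt_psi_sub`): small differences of exponents are invisible to χ_λ.

Since g ↦ g + ψ(g) is strictly increasing on nonzero elements (`add_psi_lt_add_psi`), leading terms
go to leading terms, and v(D a) = v(a) + ψ(v a) whenever v(a) ≠ 0. With k consisting of constants,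
this yields the axioms of differential-valued fields; the sign of the leading coefficient yields
those of H-fields.

A Hahn embedding over Ψ is obtained from the classical one over archimedean classes, on which ψ is
constant. -/

theorem IsAsymptoticCouple.psi_neg (hψ : IsAsymptoticCouple ψ) (g : G) (hg : g ≠ 0) :
    ψ ⟨-g, neg_ne_zero.2 hg⟩ = ψ ⟨g, hg⟩ := by
  have h := hψ.ac2 (-1) ⟨g, hg⟩ (by simpa using hg)
  simpa using h

theorem psiValuation_apply (hψ : IsAsymptoticCouple ψ) {g : G} (hg : g ≠ 0) :
    (psiValuation hψ).toFun g = ((⟨ψ ⟨g, hg⟩, ⟨g, hg⟩, rfl⟩ : Set.range ψ) : WithTop _) := by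
  simp [psiValuation, hg]

theorem psiValuation_eq_coe_iff (hψ : IsAsymptoticCouple ψ) {g : G} (hg : g ≠ 0)
    (l : Set.range ψ) : (psiValuation hψ).toFun g = l ↔ ψ ⟨g, hg⟩ = l := by
  rw [psiValuation_apply hψ hg, WithTop.coe_eq_coe, Subtype.ext_iff]

theorem mem_upper_psiValuation (hψ : IsAsymptoticCouple ψ) {g : G} (hg : g ≠ 0)
    {l : Set.range ψ} : g ∈ (psiValuation hψ).upper l ↔ (l : G) ≤ ψ ⟨g, hg⟩ := by
  change (l : WithTop (Set.range ψ)) ≤ (psiValuation hψ).toFun g ↔ _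
  rw [psiValuation_apply hψ hg, WithTop.coe_le_coe, ← Subtype.coe_le_coe]

theorem mem_lower_psiValuation (hψ : IsAsymptoticCouple ψ) {g : G} (hg : g ≠ 0)
    {l : Set.range ψ} : g ∈ (psiValuation hψ).lower l ↔ (l : G) < ψ ⟨g, hg⟩ := by
  change (l : WithTop (Set.range ψ)) < (psiValuation hψ).toFun g ↔ _
  rw [psiValuation_apply hψ hg, WithTop.coe_lt_coe, ← Subtype.coe_lt_coe]

variable [IsOrderedAddMonoid G]

theorem IsAsymptoticCouple.psi_abs (hψ : IsAsymptoticCouple ψ) (g : G) (hg : g ≠ 0) :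
    ψ ⟨|g|, abs_ne_zero.2 hg⟩ = ψ ⟨g, hg⟩ := by
  rcases abs_choice g with h | h
  · simp only [h]
  · simp only [h]
    exact hψ.psi_neg g hg

/-- As ψ is even, `ach` amounts to ψ being nonincreasing in the absolute value. -/
theorem IsHTypeAsymptoticCouple.psi_le_of_abs_le (hψ : IsHTypeAsymptoticCouple ψ) {g h : G}
    (hg : g ≠ 0) (hh : h ≠ 0) (hle : |g| ≤ |h|) : ψ ⟨h, hh⟩ ≤ ψ ⟨g, hg⟩ := by
  rw [← hψ.psi_abs g hg, ← hψ.psi_abs h hh, ← hψ.psi_neg _ (abs_ne_zero.2 hg),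
    ← hψ.psi_neg _ (abs_ne_zero.2 hh)]
  exact hψ.ach _ _ (neg_le_neg hle) (by simpa using hg)

/-- Write l = ψ(h) and m = ψ(g). By `ac3`, m - l < |h|, so ψ(m - l) ≥ l by H-type. Equality would
turn `ac3` for g and m - l into m < l + (m - l). -/
theorem IsHTypeAsymptoticCouple.lt_psi_sub (hψ : IsHTypeAsymptoticCouple ψ)
    {l m : Set.range ψ} (hlm : l < m) :
    (l : G) < ψ ⟨(m : G) - l, (sub_pos.2 (Subtype.coe_lt_coe.2 hlm)).ne'⟩ := by
  obtain ⟨_, ⟨h, hh⟩, rfl⟩ := l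
  obtain ⟨_, g, rfl⟩ := m
  have hlm' : ψ ⟨h, hh⟩ < ψ g := hlm
  have hpos : 0 < ψ g - ψ ⟨h, hh⟩ := sub_pos.2 hlm'
  by_contra! hle
  have hle' : ψ ⟨h, hh⟩ = ψ ⟨ψ g - ψ ⟨h, hh⟩, hpos.ne'⟩ := by
    refine le_antisymm (hψ.psi_le_of_abs_le hpos.ne' hh ?_) hle
    rw [abs_of_pos hpos]
    exact (sub_lt_iff_lt_add'.2 (hψ.ac3 g ⟨h, hh⟩)).le
  have h3 := hψ.ac3 g ⟨ψ g - ψ ⟨h, hh⟩, hpos.ne'⟩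
  rw [← hle', abs_of_pos hpos, add_sub_cancel] at h3
  exact lt_irrefl _ h3

/-- Only ψ(g) > ψ(h) needs an argument. Then `ac1` for h = (h - g) + g forces ψ(h - g) ≤ ψ(h), and
`ac3` bounds ψ(g) by ψ(h - g) + (h - g). -/
theorem IsAsymptoticCouple.add_psi_lt_add_psi (hψ : IsAsymptoticCouple ψ) {g h : G}
    (hg : g ≠ 0) (hh : h ≠ 0) (hlt : g < h) : g + ψ ⟨g, hg⟩ < h + ψ ⟨h, hh⟩ := by
  rcases le_or_gt (ψ ⟨g, hg⟩) (ψ ⟨h, hh⟩) with hle | hgt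
  · exact add_lt_add_of_lt_of_le hlt hle
  · have hne : h - g ≠ 0 := (sub_pos.2 hlt).ne'
    have h1 : ψ ⟨h - g, hne⟩ ≤ ψ ⟨h, hh⟩ := by
      have := hψ.ac1 ⟨h - g, hne⟩ ⟨g, hg⟩ (by simpa using hh)
      simp only [sub_add_cancel] at this
      rcases min_le_iff.1 this with h2 | h2
      · exact h2
      · exact absurd h2 hgt.not_ge
    have h2 := hψ.ac3 ⟨g, hg⟩ ⟨h - g, hne⟩
    simp only [abs_of_pos (sub_pos.2 hlt)] at h2
    calc g + ψ ⟨g, hg⟩ < g + (ψ ⟨h - g, hne⟩ + (h - g)) := by gcongr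
      _ ≤ g + (ψ ⟨h, hh⟩ + (h - g)) := by gcongr
      _ = h + ψ ⟨h, hh⟩ := by abel

end AsymptoticCouple

/-! ### Components of a valued group. -/

namespace GroupValuation

variable {G Γ : Type*} [AddCommGroup G] [LinearOrder Γ] (w : GroupValuation G Γ)

theorem toComponent_eq_zero_iff {γ : Γ} (g : w.upper γ) :
    w.toComponent γ g = 0 ↔ (g : G) ∈ w.lower γ := by
  rw [toComponent, QuotientAddGroup.mk'_apply, QuotientAddGroup.eq_zero_iff,
    AddSubgroup.mem_addSubgroupOf]

theorem toComponent_surjective (γ : Γ) : Function.Surjective (w.toComponent γ) :=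
  QuotientAddGroup.mk'_surjective _

theorem eq_coe_of_mem_upper_of_notMem_lower {γ : Γ} {g : G} (h : g ∈ w.upper γ)
    (hlow : g ∉ w.lower γ) : w.toFun g = γ :=
  le_antisymm (not_lt.1 hlow) h

/-- A homomorphism on `G^γ` that vanishes exactly on `G_γ` induces an embedding of `B_γ`. -/
theorem exists_component_lift {γ : Γ} {V : Type*} [AddCommGroup V] (f : w.upper γ →+ V)
    (hf : ∀ g : w.upper γ, f g = 0 ↔ (g : G) ∈ w.lower γ) :
    ∃ F : w.Component γ →+ V, Function.Injective F ∧ ∀ g, F (w.toComponent γ g) = f g := by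
  refine ⟨QuotientAddGroup.lift _ f fun g hg => (hf g).2 hg, ?_, fun g => rfl⟩
  rw [injective_iff_map_eq_zero]
  intro b hb
  obtain ⟨g, rfl⟩ := w.toComponent_surjective γ b
  exact (w.toComponent_eq_zero_iff g).2 ((hf g).1 hb)

end GroupValuation

/-! ### Existence of Hahn embeddings -/

/-- Nonzero integers act invertibly on V, so the universal property of localization applies.
Injectivity passes to the hull because every element has a positive multiple coming from M. -/
theorem DivisibleHull.exists_linearMap_extending {M V : Type*} [AddCommGroup M] [AddCommGroup V]
    [Module ℚ V] (f : M →+ V) :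
    ∃ F : DivisibleHull M →ₗ[ℚ] V, (∀ m, F (DivisibleHull.coe m) = f m) ∧
      (Function.Injective f → Function.Injective F) := by
  have hunit : ∀ x : nonZeroDivisors ℕ, IsUnit (algebraMap ℕ (Module.End ℕ V) x) := by
    intro x
    have hx : ((x : ℕ) : ℚ) ≠ 0 := Nat.cast_ne_zero.2 (nonZeroDivisors.ne_zero x.2)
    rw [Module.End.isUnit_iff]
    refine ⟨fun a b hab => ?_, fun b => ⟨((x : ℕ) : ℚ)⁻¹ • b, ?_⟩⟩
    · simp only [Module.algebraMap_end_apply, ← Nat.cast_smul_eq_nsmul ℚ] at hab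
      exact smul_right_injective V hx hab
    · simp only [Module.algebraMap_end_apply, ← Nat.cast_smul_eq_nsmul ℚ]
      exact smul_inv_smul₀ hx b
  let F : DivisibleHull M →ₗ[ℚ] V :=
    (LocalizedModule.lift (nonZeroDivisors ℕ) f.toNatLinearMap hunit).toAddMonoidHom.toRatLinearMap
  have hF : ∀ m, F (DivisibleHull.coe m) = f m := by
    intro m
    change LocalizedModule.lift (nonZeroDivisors ℕ) f.toNatLinearMap hunit
      (LocalizedModule.mk m _) = f m
    have h1 : PNat.equivNonZeroDivisorsNat 1 = 1 := rfl
    rw [h1]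
    exact LinearMap.congr_fun (LocalizedModule.lift_comp (nonZeroDivisors ℕ) f.toNatLinearMap
      hunit) m
  refine ⟨F, hF, fun hf => ?_⟩
  rw [injective_iff_map_eq_zero]
  intro x hx
  induction x with | mk m s
  have h1 : F (s.val • DivisibleHull.mk m s) = f m := by
    rw [← hF, DivisibleHull.nsmul_mk]
    congr 1
    exact DivisibleHull.mk_eq_mk.2 ⟨1, by simp⟩
  rw [map_nsmul, hx, smul_zero] at h1
  rw [(map_eq_zero_iff f hf).1 h1.symm, DivisibleHull.mk_zero]

/-- The classical Hahn embedding Φ sends G into real series over archimedean classes. Grouping these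
classes by their value under ψ cuts Φ(g) into blocks indexed by Ψ; a rational-linear retraction of
each block onto the divisible hull of B_l gives the coordinate g_l. -/
theorem exists_isHahnEmbedding {G : Type*} [AddCommGroup G] [LinearOrder G] [IsOrderedAddMonoid G]
    {ψ : {g : G // g ≠ 0} → G} (hψ : IsHTypeAsymptoticCouple ψ) :
    ∃ ι, IsHahnEmbedding (psiValuation hψ.toIsAsymptoticCouple) ι := by
  classical
  set w := psiValuation hψ.toIsAsymptoticCouple with hw
  obtain ⟨Φ, -, hΦ⟩ := hahnEmbedding_isOrderedAddMonoid G
  -- Larger classes consist of smaller elements: |b| ≤ n|a| gives ψ(a) = ψ(na) ≤ ψ(b), so ψ descends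
  -- to a monotone map on classes.
  let p : FiniteArchimedeanClass G →o Set.range ψ :=
    FiniteArchimedeanClass.liftOrderHom (fun a => ⟨ψ a, a, rfl⟩) (by
      rintro ⟨a, ha⟩ ⟨b, hb⟩ hab
      obtain ⟨n, hn⟩ := ArchimedeanClass.mk_le_mk.1 hab
      have hna : n • a ≠ 0 := by
        intro h0
        rw [← abs_nsmul, h0, abs_zero] at hn
        exact hb (abs_nonpos_iff.1 hn)
      change ψ ⟨a, ha⟩ ≤ ψ ⟨b, hb⟩
      have h2 := hψ.ac2 n ⟨a, ha⟩ (by simpa using hna)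
      simp only [natCast_zsmul] at h2
      rw [← h2]
      exact hψ.psi_le_of_abs_le hb hna (by rwa [abs_nsmul]))
  have hp : ∀ a (ha : a ≠ 0), (p (FiniteArchimedeanClass.mk a ha) : WithTop _) = w.toFun a := by
    intro a ha
    rw [hw, psiValuation_apply _ ha, FiniteArchimedeanClass.liftOrderHom_mk]
  have horder : ∀ a (ha : a ≠ 0),
      (ofLex (Φ a)).orderTop = (FiniteArchimedeanClass.mk a ha : FiniteArchimedeanClass G) := by
    intro a ha
    apply (FiniteArchimedeanClass.withTopOrderIso G).injective
    rw [← hΦ, FiniteArchimedeanClass.withTopOrderIso_apply_coe]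
    rfl
  -- `R l g` is the block of Φ(g) over the classes sent to l. It is defined on all of G, which is
  -- what later makes the coordinate g_l available outside G^l.
  let R : Set.range ψ → G →+ (FiniteArchimedeanClass G → ℝ) := fun l =>
    { toFun := fun g c => if p c = l then (ofLex (Φ g)).coeff c else 0
      map_zero' := by ext c; simp
      map_add' := fun g h => by ext c; by_cases hc : p c = l <;> simp [hc] }
  have hR0 : ∀ l g, g ∈ w.lower l → R l g = 0 := by
    intro l g hg
    by_cases hg0 : g = 0
    · rw [hg0, map_zero]
    ext c
    change (if p c = l then (ofLex (Φ g)).coeff c else 0) = 0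
    split_ifs with hc
    · by_contra hne
      have h1 := orderTop_le_of_coeff_ne_zero hne
      rw [horder g hg0, WithTop.coe_le_coe] at h1
      have h2 : (p (FiniteArchimedeanClass.mk g hg0) : WithTop (Set.range ψ)) ≤ p c :=
        WithTop.coe_le_coe.2 (p.monotone h1)
      rw [hp, hc] at h2
      exact absurd hg h2.not_gt
    · rfl
  have hR1 : ∀ (l : Set.range ψ) g, w.toFun g = l → R l g ≠ 0 := by
    intro l g hg h0
    have hg0 : g ≠ 0 := by
      rintro rfl
      rw [(w.eq_top_iff' 0).2 rfl] at hg
      exact WithTop.top_ne_coe hg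
    have h1 := congrFun h0 (FiniteArchimedeanClass.mk g hg0)
    have h2 : p (FiniteArchimedeanClass.mk g hg0) = l := by
      rw [← WithTop.coe_eq_coe, hp, hg]
    change (if p _ = l then (ofLex (Φ g)).coeff _ else 0) = 0 at h1
    rw [if_pos h2] at h1
    exact coeff_orderTop_ne (horder g hg0) h1
  have key : ∀ l, ∃ r : (FiniteArchimedeanClass G → ℝ) →ₗ[ℚ] DivisibleHull (w.Component l),
      (∀ g : w.upper l, r (R l g) = DivisibleHull.coe (w.toComponent l g)) ∧
        ∀ g, w.toFun g = l → r (R l g) ≠ 0 := by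
    intro l
    obtain ⟨j, hj, hjR⟩ := w.exists_component_lift ((R l).comp (w.upper l).subtype) (by
      intro g
      refine ⟨fun h => ?_, fun h => hR0 l g h⟩
      by_contra hg
      exact hR1 l g (w.eq_coe_of_mem_upper_of_notMem_lower g.2 hg) h)
    -- The block map embeds B_l, hence its divisible hull, into a rational vector space, where the
    -- image of the hull is a direct summand.
    obtain ⟨F, hF, hFinj⟩ := DivisibleHull.exists_linearMap_extending j
    obtain ⟨r, hr⟩ := LinearMap.exists_leftInverse_of_injective F
      (LinearMap.ker_eq_bot.2 (hFinj hj))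
    have h1 : ∀ g : w.upper l, R l g = F (DivisibleHull.coe (w.toComponent l g)) := by
      intro g
      rw [hF, hjR]
      rfl
    have h2 : ∀ g : w.upper l, r (R l g) = DivisibleHull.coe (w.toComponent l g) := by
      intro g
      rw [h1]
      exact LinearMap.congr_fun hr _
    refine ⟨r, h2, fun g hg h0 => hR1 l g hg ?_⟩
    have h3 := h2 ⟨g, hg.ge⟩
    have h4 := h1 ⟨g, hg.ge⟩
    rw [← h3] at h4
    rw [h4, h0, map_zero]
  choose r hr hr0 using key
  let ι : G →+ hahnProduct (fun l => DivisibleHull (w.Component l)) :=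
    { toFun := fun g => ⟨fun l => r l (R l g), by
        refine (((ofLex (Φ g)).isPWO_support.image_of_monotone p.monotone).isWF).mono ?_
        intro l hl
        have h1 : R l g ≠ 0 := fun h => hl (by simp only [h, map_zero])
        obtain ⟨c, hc⟩ := Function.ne_iff.1 h1
        change (if p c = l then (ofLex (Φ g)).coeff c else 0) ≠ 0 at hc
        by_cases hcl : p c = l
        · rw [if_pos hcl] at hc
          exact ⟨c, hc, hcl⟩
        · rw [if_neg hcl] at hc
          exact absurd rfl hc⟩
      map_zero' := by
        ext l
        simp
      map_add' := fun g h => by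
        ext l
        simp }
  have hι : ∀ g l, (ι g : ∀ l, DivisibleHull (w.Component l)) l = r l (R l g) := fun _ _ => rfl
  refine ⟨ι, ⟨fun g l hg => ⟨hr0 l g hg, fun m hm => ?_⟩, fun l g => hr l g⟩⟩
  by_contra! hlt
  apply hm
  rw [hι, hR0 m g (by change (m : WithTop _) < w.toFun g; rw [hg]; exact WithTop.coe_lt_coe.2 hlt),
    map_zero]

/-! ### Twisting power series by additive characters -/

namespace HahnSeries

variable {G k : Type*} [AddCommGroup G] [LinearOrder G] [Field k]

/-- The map `∑ a_g t^g ↦ ∑ a_g χ(g) t^g`. -/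
noncomputable def twist (χ : G →+ k) (a : k⟦G⟧) : k⟦G⟧ where
  coeff g := a.coeff g * χ g
  isPWO_support' := a.isPWO_support.mono fun _ hg => left_ne_zero_of_mul hg

@[simp]
theorem coeff_twist (χ : G →+ k) (a : k⟦G⟧) (g : G) : (twist χ a).coeff g = a.coeff g * χ g :=
  rfl

theorem support_twist_subset (χ : G →+ k) (a : k⟦G⟧) : (twist χ a).support ⊆ a.support :=
  fun _ hg => left_ne_zero_of_mul hg

theorem twist_add (χ : G →+ k) (a b : k⟦G⟧) : twist χ (a + b) = twist χ a + twist χ b := by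
  ext g
  simp [add_mul]

variable [IsOrderedAddMonoid G]

/-- The Leibniz rule is χ(g + h) = χ(g) + χ(h), read on monomials. -/
theorem twist_mul (χ : G →+ k) (a b : k⟦G⟧) :
    twist χ (a * b) = a * twist χ b + b * twist χ a := by
  ext g
  -- Twisting may shrink supports; the products are summed over the untwisted supports so that all
  -- three sums share one index set.
  rw [mul_comm b, coeff_twist, coeff_add, coeff_mul,
    coeff_mul_right' b.isPWO_support (support_twist_subset χ b),
    coeff_mul_left' a.isPWO_support (support_twist_subset χ a), Finset.sum_mul,
    ← Finset.sum_add_distrib]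
  refine Finset.sum_congr rfl fun x hx => ?_
  rw [← (Finset.mem_antidiagonal.1 hx).2.2, map_add, coeff_twist, coeff_twist]
  ring

end HahnSeries

/-! ### The derivation -/

section Derivation

variable {G k : Type*} [AddCommGroup G] [LinearOrder G] [Field k] {ψ : {g : G // g ≠ 0} → G}

/-- A family `(χ_λ)` of additive characters of `G`, indexed by `Ψ`, such that for every `g ≠ 0` the
set of all `λ` with `χ_λ(g) ≠ 0` is well-ordered with least element `ψ g`. -/
structure IsPsiFamily (ψ : {g : G // g ≠ 0} → G) (χ : Set.range ψ → G →+ k) : Prop where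
  isWF_support : ∀ g, {l | χ l g ≠ 0}.IsWF
  psi_le : ∀ (g : G) (hg : g ≠ 0) (l : Set.range ψ), χ l g ≠ 0 → ψ ⟨g, hg⟩ ≤ l
  apply_psi_ne_zero : ∀ (g : G) (hg : g ≠ 0), χ ⟨ψ ⟨g, hg⟩, ⟨g, hg⟩, rfl⟩ g ≠ 0

variable [IsOrderedAddMonoid G] {χ : Set.range ψ → G →+ k}

namespace IsPsiFamily

/-- Both halves of summability follow from this: a strictly decreasing sequence of exponents and an
infinite fibre over one exponent each give an injective sequence of pairs (g_n, λ_n) with g_n + λ_n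
nonincreasing. -/
theorem not_antitone (hψ : IsHTypeAsymptoticCouple ψ) (hχ : IsPsiFamily ψ χ) {s : Set G}
    (hs : s.IsPWO) {p : ℕ → G × Set.range ψ} (hp : Function.Injective p)
    (hps : ∀ n, (p n).1 ∈ s) (hpχ : ∀ n, χ (p n).2 (p n).1 ≠ 0) :
    ¬ Antitone fun n => (p n).1 + ((p n).2 : G) := by
  intro hanti
  obtain ⟨φ, hφ⟩ := hs.exists_monotone_subseq hps
  have hmono : ∀ m n, m ≤ n → (p (φ m)).1 ≤ (p (φ n)).1 := fun m n h => hφ h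
  have hle : ∀ m n, m ≤ n →
      (p (φ n)).1 + ((p (φ n)).2 : G) ≤ (p (φ m)).1 + ((p (φ m)).2 : G) :=
    fun m n h => hanti (φ.monotone h)
  -- After making g_n nondecreasing, every λ_n lies in the support of the single element g_0. If g_n
  -- > g_0, then 0 < g_n - g_0 ≤ λ_0 - λ_n, so ψ(g_n - g_0) ≥ ψ(λ_0 - λ_n) > λ_n. Thus χ_{λ_n}
  -- vanishes on g_n - g_0 and takes the same nonzero value at g_0 as at g_n.
  have hmem : ∀ n, (p (φ n)).2 ∈ {l | χ l (p (φ 0)).1 ≠ 0} := by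
    intro n
    rcases (hmono 0 n n.zero_le).eq_or_lt with h | h
    · change χ (p (φ n)).2 (p (φ 0)).1 ≠ 0
      rw [h]
      exact hpχ _
    · have hpos : 0 < (p (φ n)).1 - (p (φ 0)).1 := sub_pos.2 h
      have hd : (p (φ n)).1 - (p (φ 0)).1 ≤ ((p (φ 0)).2 : G) - (p (φ n)).2 := by
        rw [sub_le_sub_iff, add_comm ((p (φ 0)).2 : G)]
        exact hle 0 n n.zero_le
      have hlt : (p (φ n)).2 < (p (φ 0)).2 :=
        Subtype.coe_lt_coe.1 (sub_pos.1 (hpos.trans_le hd))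
      have h1 := hψ.lt_psi_sub hlt
      have h2 := hψ.psi_le_of_abs_le hpos.ne' (hpos.trans_le hd).ne'
        (by rwa [abs_of_pos hpos, abs_of_pos (hpos.trans_le hd)])
      have h3 : χ (p (φ n)).2 ((p (φ n)).1 - (p (φ 0)).1) = 0 := by
        by_contra hne
        exact absurd (hχ.psi_le _ hpos.ne' _ hne) (h1.trans_le h2).not_ge
      rw [map_sub, sub_eq_zero] at h3
      change χ (p (φ n)).2 (p (φ 0)).1 ≠ 0
      rw [← h3]
      exact hpχ _
  -- That support is well-ordered, so λ_n may also be taken nondecreasing. Since the sums are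
  -- nonincreasing, two pairs must coincide, against injectivity.
  obtain ⟨θ, hθ⟩ := (hχ.isWF_support _).isPWO.exists_monotone_subseq hmem
  have h01 : θ 0 ≤ θ 1 := θ.monotone zero_le_one
  have hl : ((p (φ (θ 0))).2 : G) ≤ (p (φ (θ 1))).2 := hθ zero_le_one
  have hg := hmono _ _ h01
  have hgl := hle _ _ h01
  have hg' : (p (φ (θ 0))).1 = (p (φ (θ 1))).1 :=
    le_antisymm hg (le_of_add_le_add_right (hgl.trans (add_le_add_right hl _)))
  have hl' : (p (φ (θ 0))).2 = (p (φ (θ 1))).2 := by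
    refine Subtype.ext (le_antisymm hl ?_)
    rw [hg'] at hgl
    exact le_of_add_le_add_left hgl
  have := φ.injective (hp (Prod.ext hg' hl'))
  exact absurd (θ.injective this) zero_ne_one

theorem isPWO_image_add (hψ : IsHTypeAsymptoticCouple ψ) (hχ : IsPsiFamily ψ χ) {s : Set G}
    (hs : s.IsPWO) :
    ((fun p : G × Set.range ψ => p.1 + (p.2 : G)) '' {p | p.1 ∈ s ∧ χ p.2 p.1 ≠ 0}).IsPWO := by
  refine Set.IsWF.isPWO (Set.isWF_iff_no_descending_seq.2 fun f hf hmem => ?_)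
  choose p hp hpf using hmem
  refine hχ.not_antitone hψ hs (p := p) (fun m n hmn => hf.injective ?_) (fun n => (hp n).1)
    (fun n => (hp n).2) ?_
  · rw [← hpf, ← hpf, hmn]
  · have : (fun n => (p n).1 + ((p n).2 : G)) = f := funext hpf
    rw [this]
    exact hf.antitone

theorem finite_fiber_add (hψ : IsHTypeAsymptoticCouple ψ) (hχ : IsPsiFamily ψ χ) {s : Set G}
    (hs : s.IsPWO) (h : G) :
    {p : G × Set.range ψ | (p.1 ∈ s ∧ χ p.2 p.1 ≠ 0) ∧ p.1 + (p.2 : G) = h}.Finite := by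
  by_contra hinf
  let e := Set.Infinite.natEmbedding _ hinf
  refine hχ.not_antitone hψ hs (p := fun n => (e n : G × Set.range ψ))
    (Subtype.val_injective.comp e.injective) (fun n => (e n).2.1.1) (fun n => (e n).2.1.2) ?_
  intro m n _
  exact ((e n).2.2.trans (e m).2.2.symm).le

/-- The family of all `a_g χ_λ(g) t^(g + λ)`. -/
noncomputable def termFamily (hψ : IsHTypeAsymptoticCouple ψ) (hχ : IsPsiFamily ψ χ) (a : k⟦G⟧) :
    SummableFamily G k ({g : G // g ≠ 0} × Set.range ψ) where
  toFun p := single ((p.1 : G) + (p.2 : G)) (a.coeff p.1 * χ p.2 p.1)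
  isPWO_iUnion_support' := by
    refine (hχ.isPWO_image_add hψ a.isPWO_support).mono ?_
    refine Set.iUnion_subset fun p h hh => ?_
    have h1 := support_single_subset hh
    rw [Set.mem_singleton_iff] at h1
    rw [mem_support, h1, coeff_single_same] at hh
    exact ⟨(p.1, p.2), ⟨left_ne_zero_of_mul hh, right_ne_zero_of_mul hh⟩, h1.symm⟩
  finite_co_support' h := by
    refine Set.Finite.of_finite_image (f := fun p => ((p.1 : G), p.2))
      ((hχ.finite_fiber_add hψ a.isPWO_support h).subset ?_) ?_
    · rintro _ ⟨p, hp, rfl⟩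
      have h1 := support_single_subset (mem_support _ _ |>.2 hp)
      rw [Set.mem_singleton_iff] at h1
      rw [Set.mem_ofPred_eq, h1, coeff_single_same] at hp
      exact ⟨⟨left_ne_zero_of_mul hp, right_ne_zero_of_mul hp⟩, h1.symm⟩
    · rintro ⟨⟨g, hg⟩, l⟩ - ⟨⟨g', hg'⟩, l'⟩ - h
      simpa using h

/-- The family of all `t^λ ∑_g a_g χ_λ(g) t^g`. -/
noncomputable def twistFamily (hψ : IsHTypeAsymptoticCouple ψ) (hχ : IsPsiFamily ψ χ)
    (a : k⟦G⟧) : SummableFamily G k (Set.range ψ) where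
  toFun l := single (l : G) 1 * twist (χ l) a
  isPWO_iUnion_support' := by
    refine (hχ.isPWO_image_add hψ a.isPWO_support).mono ?_
    refine Set.iUnion_subset fun l h hh => ?_
    rw [mem_support, coeff_single_mul, one_mul] at hh
    exact ⟨(h - l, l), ⟨left_ne_zero_of_mul hh, right_ne_zero_of_mul hh⟩, sub_add_cancel _ _⟩
  finite_co_support' h := by
    refine Set.Finite.of_finite_image (f := fun l : Set.range ψ => (h - l, l))
      ((hχ.finite_fiber_add hψ a.isPWO_support h).subset ?_) ?_
    · rintro _ ⟨l, hl, rfl⟩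
      rw [Set.mem_ofPred_eq, coeff_single_mul, one_mul] at hl
      exact ⟨⟨left_ne_zero_of_mul hl, right_ne_zero_of_mul hl⟩, sub_add_cancel _ _⟩
    · intro l _ l' _ h
      exact (Prod.ext_iff.1 h).2

theorem coeff_twistFamily (hψ : IsHTypeAsymptoticCouple ψ) (hχ : IsPsiFamily ψ χ) (a : k⟦G⟧)
    (l : Set.range ψ) (h : G) :
    (hχ.twistFamily hψ a l).coeff h = a.coeff (h - l) * χ l (h - l) := by
  change (single (l : G) 1 * twist (χ l) a).coeff h = _
  rw [coeff_single_mul, one_mul, coeff_twist]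

/-- The left family is formula (†); the right one is visibly a sum of derivations. At exponent h
only the pairs (h - λ, λ) contribute, so projection to λ matches the nonzero terms. Leaving out g =
0 loses nothing, as χ_λ(0) = 0. -/
theorem hsum_termFamily (hψ : IsHTypeAsymptoticCouple ψ) (hχ : IsPsiFamily ψ χ) (a : k⟦G⟧) :
    (hχ.termFamily hψ a).hsum = (hχ.twistFamily hψ a).hsum := by
  ext h
  rw [SummableFamily.coeff_hsum, SummableFamily.coeff_hsum, ← finsum_mem_support,
    ← finsum_mem_support (fun l => (hχ.twistFamily hψ a l).coeff h)]
  have hterm : ∀ p, (hχ.termFamily hψ a p).coeff h =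
      if h = (p.1 : G) + p.2 then a.coeff p.1 * χ p.2 p.1 else 0 := by
    intro p
    change (single ((p.1 : G) + (p.2 : G)) (a.coeff p.1 * χ p.2 p.1)).coeff h = _
    rw [coeff_single]
    congr
  have hsub : ∀ p : {g : G // g ≠ 0} × Set.range ψ, (hχ.termFamily hψ a p).coeff h ≠ 0 →
      h - p.2 = p.1 := by
    intro p hp
    rw [hterm, ite_ne_right_iff] at hp
    rw [hp.1, add_sub_cancel_right]
  have heq : ∀ p : {g : G // g ≠ 0} × Set.range ψ, h - p.2 = p.1 →
      (hχ.termFamily hψ a p).coeff h = (hχ.twistFamily hψ a p.2).coeff h := by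
    intro p hp
    rw [hterm, coeff_twistFamily, hp, if_pos (sub_eq_iff_eq_add.1 hp)]
  refine finsum_mem_eq_of_bijOn Prod.snd ⟨fun p hp => ?_, fun p hp q hq hpq => ?_, fun l hl => ?_⟩
    fun p hp => heq p (hsub p hp)
  · rw [Function.mem_support] at hp ⊢
    rwa [← heq p (hsub p hp)]
  · refine Prod.ext (Subtype.ext ?_) hpq
    rw [← hsub p hp, ← hsub q hq, hpq]
  · rw [Function.mem_support] at hl
    have hne : h - (l : G) ≠ 0 := by
      intro h0
      rw [coeff_twistFamily, h0, map_zero, mul_zero] at hl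
      exact hl rfl
    refine ⟨(⟨h - l, hne⟩, l), ?_, rfl⟩
    rw [Function.mem_support, heq _ rfl]
    exact hl

/-- The derivation `∑ a_g t^g ↦ ∑_{g, λ} a_g χ_λ(g) t^(g + λ)`. -/
noncomputable def derivation (hψ : IsHTypeAsymptoticCouple ψ) (hχ : IsPsiFamily ψ χ) :
    Derivation ℤ k⟦G⟧ k⟦G⟧ :=
  Derivation.mk'
    (AddMonoidHom.toIntLinearMap <| AddMonoidHom.mk' (fun a => (hχ.twistFamily hψ a).hsum)
      fun a b => by
        rw [← SummableFamily.hsum_add]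
        congr 1
        ext1 l
        change single (l : G) 1 * twist (χ l) (a + b) =
          single (l : G) 1 * twist (χ l) a + single (l : G) 1 * twist (χ l) b
        rw [twist_add, mul_add])
    fun a b => by
      change (hχ.twistFamily hψ (a * b)).hsum =
        a * (hχ.twistFamily hψ b).hsum + b * (hχ.twistFamily hψ a).hsum
      -- Multiplication by a series commutes with summation, so the Leibniz rule may be checked for
      -- each λ separately.
      rw [← SummableFamily.hsum_smul, ← SummableFamily.hsum_smul, ← SummableFamily.hsum_add]
      congr 1
      ext1 l
      rw [SummableFamily.add_apply, SummableFamily.smul_apply, SummableFamily.smul_apply,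
        of_symm_smul_of_eq_mul, of_symm_smul_of_eq_mul]
      change single (l : G) 1 * twist (χ l) (a * b) =
        a * (single (l : G) 1 * twist (χ l) b) + b * (single (l : G) 1 * twist (χ l) a)
      rw [twist_mul]
      ring

theorem derivation_apply (hψ : IsHTypeAsymptoticCouple ψ) (hχ : IsPsiFamily ψ χ) (a : k⟦G⟧) :
    hχ.derivation hψ a = (hχ.twistFamily hψ a).hsum :=
  rfl

theorem coeff_derivation (hψ : IsHTypeAsymptoticCouple ψ) (hχ : IsPsiFamily ψ χ) (a : k⟦G⟧)
    (h : G) : (hχ.derivation hψ a).coeff h =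
      ∑ᶠ l : Set.range ψ, a.coeff (h - l) * χ l (h - l) := by
  rw [derivation_apply, SummableFamily.coeff_hsum]
  exact finsum_congr fun l => hχ.coeff_twistFamily hψ a l h

theorem derivation_C (hψ : IsHTypeAsymptoticCouple ψ) (hχ : IsPsiFamily ψ χ) (c : k) :
    hχ.derivation hψ (single 0 c) = 0 := by
  ext h
  rw [coeff_derivation, coeff_zero]
  refine finsum_eq_zero_of_forall_eq_zero fun l => ?_
  by_cases hl : h - (l : G) = 0
  · rw [hl, map_zero, mul_zero]
  · rw [coeff_single_of_ne hl, zero_mul]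

/-- Every term of `D a` has exponent at least `g + ψ g`, where `g = v a`, with equality only for
the leading one. -/
theorem le_of_term_ne_zero (hψ : IsHTypeAsymptoticCouple ψ) (hχ : IsPsiFamily ψ χ) {a : k⟦G⟧}
    {g : G} (hg : g ≠ 0) (ha : a.orderTop = g) {h : G} {l : Set.range ψ}
    (hl : a.coeff (h - l) * χ l (h - l) ≠ 0) :
    g + ψ ⟨g, hg⟩ ≤ h ∧ (h = g + ψ ⟨g, hg⟩ → (l : G) = ψ ⟨g, hg⟩) := by
  have hle : g ≤ h - l := by
    have := orderTop_le_of_coeff_ne_zero (left_ne_zero_of_mul hl)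
    rwa [ha, WithTop.coe_le_coe] at this
  have hne : h - (l : G) ≠ 0 := by
    intro h0
    rw [h0, map_zero, mul_zero] at hl
    exact hl rfl
  have hψl := hχ.psi_le _ hne l (right_ne_zero_of_mul hl)
  -- The term comes from g' = h - l ≥ g with l ≥ ψ(g'), so h ≥ g' + ψ(g') ≥ g + ψ(g), the last
  -- inequality being strict unless g' = g.
  rcases hle.eq_or_lt with heq | hlt
  · have hh : h = g + l := by rw [heq, sub_add_cancel]
    have hψl' : ψ ⟨g, hg⟩ ≤ l := by
      convert hψl
    refine ⟨?_, fun h' => ?_⟩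
    · rw [hh]
      gcongr
    · rw [hh] at h'
      exact add_left_cancel h'
  · have h1 := hψ.add_psi_lt_add_psi hg hne hlt
    have h2 : g + ψ ⟨g, hg⟩ < h := by
      calc g + ψ ⟨g, hg⟩ < (h - l) + ψ ⟨h - l, hne⟩ := h1
        _ ≤ (h - l) + l := by gcongr
        _ = h := sub_add_cancel _ _
    exact ⟨h2.le, fun h' => absurd h' h2.ne'⟩

theorem coeff_derivation_add_psi (hψ : IsHTypeAsymptoticCouple ψ) (hχ : IsPsiFamily ψ χ)
    {a : k⟦G⟧} {g : G} (hg : g ≠ 0) (ha : a.orderTop = g) :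
    (hχ.derivation hψ a).coeff (g + ψ ⟨g, hg⟩) =
      a.coeff g * χ ⟨ψ ⟨g, hg⟩, ⟨g, hg⟩, rfl⟩ g := by
  rw [coeff_derivation, finsum_eq_single _ ⟨ψ ⟨g, hg⟩, ⟨g, hg⟩, rfl⟩]
  · simp only [add_sub_cancel_right]
  · intro l hl
    by_contra hne
    exact hl (Subtype.ext ((hχ.le_of_term_ne_zero hψ hg ha hne).2 rfl))

/-- This formula for v(D a), together with D vanishing on k, is all that the axioms of
differential-valued fields require of D. -/
theorem orderTop_derivation (hψ : IsHTypeAsymptoticCouple ψ) (hχ : IsPsiFamily ψ χ)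
    {a : k⟦G⟧} {g : G} (hg : g ≠ 0) (ha : a.orderTop = g) :
    (hχ.derivation hψ a).orderTop = (g + ψ ⟨g, hg⟩ : G) := by
  refine orderTop_eq_of_le ?_ fun h hh => ?_
  · rw [mem_support, hχ.coeff_derivation_add_psi hψ hg ha]
    exact mul_ne_zero (coeff_orderTop_ne ha) (hχ.apply_psi_ne_zero g hg)
  · rw [mem_support, coeff_derivation] at hh
    obtain ⟨l, hl⟩ : ∃ l : Set.range ψ, a.coeff (h - l) * χ l (h - l) ≠ 0 := by
      by_contra! h0
      exact hh (finsum_eq_zero_of_forall_eq_zero h0)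
    exact (hχ.le_of_term_ne_zero hψ hg ha hl).1

theorem leadingCoeff_derivation (hψ : IsHTypeAsymptoticCouple ψ) (hχ : IsPsiFamily ψ χ)
    {a : k⟦G⟧} {g : G} (hg : g ≠ 0) (ha : a.orderTop = g) :
    (hχ.derivation hψ a).leadingCoeff =
      a.leadingCoeff * χ ⟨ψ ⟨g, hg⟩, ⟨g, hg⟩, rfl⟩ g := by
  have key : ∀ (b : k⟦G⟧) (h : G), b.orderTop = h → b.leadingCoeff = b.coeff h := by
    intro b h hb
    rw [← coeff_untop_eq_leadingCoeff (hx := by rw [hb]; exact WithTop.coe_ne_top)]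
    simp only [hb, WithTop.untop_coe]
  rw [key _ _ (hχ.orderTop_derivation hψ hg ha), hχ.coeff_derivation_add_psi hψ hg ha, key a g ha]

end IsPsiFamily

end Derivation

/-! ### Characters from Hahn embeddings -/

section Characters

variable {G k : Type*} [AddCommGroup G] [LinearOrder G] [Field k] {ψ : {g : G // g ≠ 0} → G}

theorem exists_toComponent_ne_zero (hψ : IsAsymptoticCouple ψ) (l : Set.range ψ) :
    ∃ g : (psiValuation hψ).upper l, (psiValuation hψ).toComponent l g ≠ 0 := by
  obtain ⟨_, ⟨g, hg⟩, rfl⟩ := l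
  refine ⟨⟨g, (mem_upper_psiValuation hψ hg).2 le_rfl⟩, fun h0 => ?_⟩
  rw [GroupValuation.toComponent_eq_zero_iff, mem_lower_psiValuation hψ hg] at h0
  exact lt_irrefl _ h0

theorem component_nsmul_eq_zero (hψ : IsAsymptoticCouple ψ) {l : Set.range ψ} {n : ℕ}
    (hn : n ≠ 0) [IsOrderedAddMonoid G] {b : (psiValuation hψ).Component l} (hb : n • b = 0) :
    b = 0 := by
  obtain ⟨⟨g, hgu⟩, rfl⟩ := (psiValuation hψ).toComponent_surjective l b
  rw [← map_nsmul, GroupValuation.toComponent_eq_zero_iff] at hb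
  rw [GroupValuation.toComponent_eq_zero_iff]
  change n • g ∈ _ at hb
  by_cases hg : g = 0
  · simp only [hg]
    exact zero_mem _
  have hng : n • g ≠ 0 := (nsmul_eq_zero_iff_right hn).not.2 hg
  rw [mem_lower_psiValuation hψ hng] at hb
  rw [mem_lower_psiValuation hψ hg]
  have h2 := hψ.ac2 n ⟨g, hg⟩ (by simpa using hng)
  simp only [natCast_zsmul] at h2
  rwa [h2] at hb

/-- Components are torsion-free by `ac2` and nonzero since l is a value of ψ. Characteristic zero is
what lets maps into k extend to divisible hulls. -/
theorem charZero_of_component_embedding [IsOrderedAddMonoid G] (hψ : IsAsymptoticCouple ψ)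
    {l : Set.range ψ} (u : (psiValuation hψ).Component l →+ k) (hu : Function.Injective u) :
    CharZero k := by
  obtain ⟨g, hg⟩ := exists_toComponent_ne_zero hψ l
  refine charZero_of_inj_zero fun n hn => ?_
  by_contra hn0
  refine hg (component_nsmul_eq_zero hψ hn0 ((map_eq_zero_iff u hu).1 ?_))
  rw [map_nsmul, nsmul_eq_mul, hn, zero_mul]

theorem exists_divisibleHull_extension [IsOrderedAddMonoid G] (hψ : IsAsymptoticCouple ψ)
    (u : ∀ l, (psiValuation hψ).Component l →+ k) (hu : ∀ l, Function.Injective (u l)) :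
    ∃ u' : ∀ l, DivisibleHull ((psiValuation hψ).Component l) →+ k,
      ∀ l b, u' l (DivisibleHull.coe b) = u l b := by
  have h : ∀ l, ∃ f : DivisibleHull ((psiValuation hψ).Component l) →+ k,
      ∀ b, f (DivisibleHull.coe b) = u l b := by
    intro l
    have := charZero_of_component_embedding hψ (u l) (hu l)
    obtain ⟨F, hF, -⟩ := DivisibleHull.exists_linearMap_extending (u l)
    exact ⟨F.toAddMonoidHom, hF⟩
  choose f hf using h
  exact ⟨f, hf⟩

/-- The characters `g ↦ u_λ(g_λ)`. -/
noncomputable def hahnCharacter (hψ : IsAsymptoticCouple ψ)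
    (ι : G →+ hahnProduct (fun l => DivisibleHull ((psiValuation hψ).Component l)))
    (u' : ∀ l, DivisibleHull ((psiValuation hψ).Component l) →+ k) (l : Set.range ψ) : G →+ k :=
  (u' l).comp ((Pi.evalAddMonoidHom _ l).comp ((hahnProduct _).subtype.comp ι))

variable {hψ : IsAsymptoticCouple ψ}
  {ι : G →+ hahnProduct (fun l => DivisibleHull ((psiValuation hψ).Component l))}
  {u : ∀ l, (psiValuation hψ).Component l →+ k}
  {u' : ∀ l, DivisibleHull ((psiValuation hψ).Component l) →+ k}

theorem hahnCharacter_apply (l : Set.range ψ) (g : G) : hahnCharacter hψ ι u' l g =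
    u' l ((ι g : ∀ l, DivisibleHull ((psiValuation hψ).Component l)) l) :=
  rfl

theorem hahnCharacter_apply_upper (hι : IsHahnEmbedding (psiValuation hψ) ι)
    (huu' : ∀ l b, u' l (DivisibleHull.coe b) = u l b) (l : Set.range ψ)
    (g : (psiValuation hψ).upper l) :
    hahnCharacter hψ ι u' l g = u l ((psiValuation hψ).toComponent l g) := by
  rw [hahnCharacter_apply, hι.apply_upper, huu']

theorem isPsiFamily_hahnCharacter (hι : IsHahnEmbedding (psiValuation hψ) ι)
    (huu' : ∀ l b, u' l (DivisibleHull.coe b) = u l b) (hu : ∀ l, Function.Injective (u l)) :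
    IsPsiFamily ψ (hahnCharacter hψ ι u') where
  isWF_support g := by
    refine Set.IsWF.mono (ι g).2 fun l hl h0 => hl ?_
    rw [hahnCharacter_apply, h0, map_zero]
  psi_le g hg l hl := by
    have h1 := hι.isLeast_support g _ (psiValuation_apply hψ hg)
    refine Subtype.coe_le_coe.2 (h1.2 (show l ∈ {m | _} from fun h0 => hl ?_))
    rw [hahnCharacter_apply, h0, map_zero]
  apply_psi_ne_zero g hg := by
    have hgu : g ∈ (psiValuation hψ).upper ⟨ψ ⟨g, hg⟩, ⟨g, hg⟩, rfl⟩ :=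
      (mem_upper_psiValuation hψ hg).2 le_rfl
    have h1 := hahnCharacter_apply_upper hι huu' _ ⟨g, hgu⟩
    change hahnCharacter hψ ι u' _ g = _ at h1
    rw [h1, Ne, map_eq_zero_iff _ (hu _), GroupValuation.toComponent_eq_zero_iff,
      mem_lower_psiValuation hψ hg]
    exact lt_irrefl _

end Characters

/-! ### Order on the components -/

section ComponentOrder

variable {G k : Type*} [AddCommGroup G] [LinearOrder G] [Field k] [LinearOrder k]
  {ψ : {g : G // g ≠ 0} → G}

theorem componentLE_iff_of_neg [IsOrderedAddMonoid G] [IsStrictOrderedRing k]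
    (hψ : IsAsymptoticCouple ψ) {l : Set.range ψ}
    (u : (psiValuation hψ).Component l →+ k) (hu : Function.Injective u)
    (hneg : ∀ g : (psiValuation hψ).upper l, (0 : G) < g →
      (g : G) ∉ (psiValuation hψ).lower l → u ((psiValuation hψ).toComponent l g) < 0)
    (b c : (psiValuation hψ).Component l) :
    (psiValuation hψ).componentLE l b c ↔ u c ≤ u b := by
  have key : ∀ g h : (psiValuation hψ).upper l, (g : G) ≤ h →
      u ((psiValuation hψ).toComponent l h) ≤ u ((psiValuation hψ).toComponent l g) := by
    intro g h hgh
    rw [← sub_nonpos, ← map_sub, ← map_sub]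
    by_cases hmem : ((h - g : (psiValuation hψ).upper l) : G) ∈ (psiValuation hψ).lower l
    · rw [((psiValuation hψ).toComponent_eq_zero_iff _).2 hmem, map_zero]
    · refine (hneg _ (lt_of_le_of_ne ?_ ?_) hmem).le
      · simpa using hgh
      · intro h0
        rw [← h0] at hmem
        exact hmem (zero_mem _)
  refine ⟨?_, fun hle => ?_⟩
  · rintro ⟨g, h, rfl, rfl, hgh⟩
    exact key g h hgh
  · obtain ⟨g, rfl⟩ := (psiValuation hψ).toComponent_surjective l b
    obtain ⟨h, rfl⟩ := (psiValuation hψ).toComponent_surjective l c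
    rcases le_total (g : G) h with hgh | hgh
    · exact ⟨g, h, rfl, rfl, hgh⟩
    -- Here h ≤ g gives u[g] ≤ u[h], so both classes have the same image and are equal; g represents
    -- both.
    · exact ⟨g, g, rfl, hu (le_antisymm (key h g hgh) hle), le_rfl⟩

theorem pos_of_componentLE_iff (hψ : IsAsymptoticCouple ψ) {l : Set.range ψ}
    (u : (psiValuation hψ).Component l →+ k) (hu : Function.Injective u)
    (hle : ∀ b c, (psiValuation hψ).componentLE l b c ↔ u c ≤ u b)
    (g : (psiValuation hψ).upper l) (hg : (g : G) < 0)
    (hgl : (g : G) ∉ (psiValuation hψ).lower l) :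
    0 < u ((psiValuation hψ).toComponent l g) := by
  refine lt_of_le_of_ne ?_ fun h0 => ?_
  · have := (hle ((psiValuation hψ).toComponent l g) 0).1 ⟨g, 0, rfl, map_zero _, hg.le⟩
    rwa [map_zero] at this
  · rw [eq_comm, map_eq_zero_iff u hu, GroupValuation.toComponent_eq_zero_iff] at h0
    exact hgl h0

end ComponentOrder

/-! ### Differential-valued fields from a valuation formula -/

section Criterion

variable {K Γ : Type*} [Field K] [AddCommGroup Γ] [LinearOrder Γ] [IsOrderedAddMonoid Γ]
  {v : AddValuation K (WithTop Γ)} {D : Derivation ℤ K K} {ψ : {g : Γ // g ≠ 0} → Γ}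

theorem valuation_div_eq {a b : K} {g h : Γ} (ha : v a = (g + h : Γ)) (hb : v b = g) :
    v (a / b) = h := by
  have hb0 : b ≠ 0 := by
    rintro rfl
    rw [AddValuation.map_zero] at hb
    exact WithTop.top_ne_coe hb
  apply WithTop.add_right_cancel (z := v b) (by rw [hb]; exact WithTop.coe_ne_top)
  rw [← AddValuation.map_mul, div_mul_cancel₀ _ hb0, ha, hb, ← WithTop.coe_add, add_comm]

theorem exists_valuation_eq_coe {a : K} (ha : a ≠ 0) : ∃ g : Γ, v a = g := by
  have h : v a ≠ ⊤ := (AddValuation.ne_top_iff v).2 ha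
  obtain ⟨g, hg⟩ := WithTop.ne_top_iff_exists.1 h
  exact ⟨g, hg.symm⟩

theorem valuation_nonneg_of_const
    (hD : ∀ (a : K) (g : Γ) (hg : g ≠ 0), v a = g → v (D a) = (g + ψ ⟨g, hg⟩ : Γ))
    {c : K} (hc : D c = 0) : 0 ≤ v c := by
  by_contra! hlt
  obtain ⟨g, hg⟩ := WithTop.ne_top_iff_exists.1 hlt.ne_top
  have hg0 : g ≠ 0 := by
    rintro rfl
    rw [← hg] at hlt
    exact lt_irrefl _ hlt
  have := hD c g hg0 hg.symm
  rw [hc, AddValuation.map_zero] at this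
  exact WithTop.top_ne_coe this

theorem hasAsymptoticCouple_of_valuation_eq (hv : Function.Surjective v)
    (hD : ∀ (a : K) (g : Γ) (hg : g ≠ 0), v a = g → v (D a) = (g + ψ ⟨g, hg⟩ : Γ)) :
    HasAsymptoticCouple v D ψ :=
  ⟨hv, fun g a ha => valuation_div_eq (hD a g g.2 ha) ha⟩

/-- Removing the constant part reduces `dv2` to an infinitesimal ε. With g = v(ε) and h = v(b), it
then reads ψ(h) < g + ψ(g), which is `ac3`. -/
theorem isDifferentialValued_of_valuation_eq (hψ : IsAsymptoticCouple ψ)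
    (hD : ∀ (a : K) (g : Γ) (hg : g ≠ 0), v a = g → v (D a) = (g + ψ ⟨g, hg⟩ : Γ))
    (hdecomp : ∀ a, 0 ≤ v a → ∃ ε c : K, 0 < v ε ∧ D c = 0 ∧ a = ε + c) :
    IsDifferentialValued v D where
  dv2 a b ha hb hb0 := by
    obtain ⟨h, hh⟩ := exists_valuation_eq_coe (v := v) hb0
    have hhpos : 0 < h := by
      rw [hh] at hb
      exact WithTop.coe_pos.1 hb
    rw [valuation_div_eq (hD b h hhpos.ne' hh) hh]
    obtain ⟨ε, c, hε, hc, rfl⟩ := hdecomp a ha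
    rw [map_add, hc, add_zero]
    by_cases hε0 : ε = 0
    · rw [hε0, map_zero, AddValuation.map_zero]
      exact WithTop.coe_lt_top _
    · obtain ⟨g, hg⟩ := exists_valuation_eq_coe (v := v) hε0
      have hgpos : 0 < g := by
        rw [hg] at hε
        exact WithTop.coe_pos.1 hε
      rw [hD ε g hgpos.ne' hg, WithTop.coe_lt_coe]
      have := hψ.ac3 ⟨h, hhpos.ne'⟩ ⟨g, hgpos.ne'⟩
      rwa [abs_of_pos hgpos, add_comm] at this
  dv1 a := by
    refine ⟨hdecomp a, ?_⟩
    rintro ⟨ε, c, hε, hc, rfl⟩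
    exact (le_min hε.le (valuation_nonneg_of_const hD hc)).trans (AddValuation.map_add v ε c)

end Criterion

/-! ### The valuation of k((G)) and logarithmic derivatives of monomials. -/

section PowerSeries

variable {G k : Type*} [AddCommGroup G] [LinearOrder G] [Field k]

/-- The splitting of a series with nonnegative valuation into an infinitesimal and a constant. -/
theorem exists_eq_add_single_zero (a : k⟦G⟧) (ha : 0 ≤ a.orderTop) :
    ∃ ε : k⟦G⟧, 0 < ε.orderTop ∧ a = ε + single 0 (a.coeff 0) := by
  refine ⟨a - single 0 (a.coeff 0), ?_, (sub_add_cancel _ _).symm⟩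
  by_contra! hle
  obtain ⟨g, hg⟩ := WithTop.ne_top_iff_exists.1 (hle.trans_lt (WithTop.coe_lt_top 0)).ne
  have hne := coeff_orderTop_ne hg.symm
  rw [← hg] at hle
  have hg0 : g ≤ 0 := WithTop.coe_le_coe.1 hle
  rcases hg0.eq_or_lt with rfl | hlt
  · rw [coeff_sub, coeff_single_same, sub_self] at hne
    exact hne rfl
  · rw [coeff_sub, coeff_single_of_ne hlt.ne, sub_zero] at hne
    exact absurd (ha.trans (orderTop_le_of_coeff_ne_zero hne))
      (not_le.2 (WithTop.coe_lt_coe.2 hlt))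

variable [IsOrderedAddMonoid G] {ψ : {g : G // g ≠ 0} → G}

theorem addVal_surjective : Function.Surjective (addVal G k) := by
  intro g
  cases g with
  | top => exact ⟨0, AddValuation.map_zero _⟩
  | coe g => exact ⟨single g 1, by rw [addVal_apply, orderTop_single one_ne_zero]⟩

theorem IsPsiFamily.isDifferentialValued {χ : Set.range ψ → G →+ k}
    (hψ : IsHTypeAsymptoticCouple ψ) (hχ : IsPsiFamily ψ χ) :
    IsDifferentialValued (addVal G k) (hχ.derivation hψ) := by
  refine isDifferentialValued_of_valuation_eq hψ.toIsAsymptoticCouple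
    (fun a g hg ha => hχ.orderTop_derivation hψ hg ha) fun a ha => ?_
  obtain ⟨ε, hε, h⟩ := exists_eq_add_single_zero a ha
  exact ⟨ε, _, hε, hχ.derivation_C hψ _, h⟩

theorem IsPsiFamily.hasAsymptoticCouple {χ : Set.range ψ → G →+ k}
    (hψ : IsHTypeAsymptoticCouple ψ) (hχ : IsPsiFamily ψ χ) :
    HasAsymptoticCouple (addVal G k) (hχ.derivation hψ) ψ :=
  hasAsymptoticCouple_of_valuation_eq addVal_surjective
    fun _ _ hg ha => hχ.orderTop_derivation hψ hg ha

theorem isGivenByFormula_derivation (hψ : IsHTypeAsymptoticCouple ψ)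
    {ι : G →+ hahnProduct
      (fun l => DivisibleHull ((psiValuation hψ.toIsAsymptoticCouple).Component l))}
    {u' : ∀ l, DivisibleHull ((psiValuation hψ.toIsAsymptoticCouple).Component l) →+ k}
    (hχ : IsPsiFamily ψ (hahnCharacter hψ.toIsAsymptoticCouple ι u')) :
    IsGivenByFormula hψ.toIsAsymptoticCouple ι u' (hχ.derivation hψ) := fun a =>
  ⟨hχ.termFamily hψ a, fun _ => rfl, (hχ.hsum_termFamily hψ a).symm⟩

/-- The logarithmic derivative of `t^g` depends additively on `g`. -/
noncomputable def logDerivSingle (D : Derivation ℤ k⟦G⟧ k⟦G⟧) : G →+ k⟦G⟧ :=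
  AddMonoidHom.mk' (fun g => D (single g 1) / single g 1) fun g h => by
    have hg : (single g (1 : k)) ≠ 0 := single_ne_zero one_ne_zero
    have hh : (single h (1 : k)) ≠ 0 := single_ne_zero one_ne_zero
    have hmul : (single (g + h) (1 : k)) = single g 1 * single h 1 := by
      rw [single_mul_single, one_mul]
    rw [hmul, Derivation.leibniz, smul_eq_mul, smul_eq_mul]
    field_simp
    ring

theorem orderTop_logDerivSingle {D : Derivation ℤ k⟦G⟧ k⟦G⟧}
    (hD : HasAsymptoticCouple (addVal G k) D ψ) {g : G} (hg : g ≠ 0) :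
    (logDerivSingle D g).orderTop = (ψ ⟨g, hg⟩ : G) :=
  hD.2 ⟨g, hg⟩ (single g 1) (by rw [addVal_apply, orderTop_single one_ne_zero])

/-- The embedding of `B_λ` into `k` that takes the class of `g` to the coefficient at `λ` of the
logarithmic derivative of `t^g`. -/
theorem exists_component_embedding_logDerivSingle (hψ : IsAsymptoticCouple ψ)
    {D : Derivation ℤ k⟦G⟧ k⟦G⟧} (hD : HasAsymptoticCouple (addVal G k) D ψ) (l : Set.range ψ) :
    ∃ u : (psiValuation hψ).Component l →+ k, Function.Injective u ∧
      ∀ g, u ((psiValuation hψ).toComponent l g) = (logDerivSingle D (g : G)).coeff l := by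
  refine (psiValuation hψ).exists_component_lift
    ((coeff.addMonoidHom (l : G)).comp ((logDerivSingle D).comp (AddSubgroup.subtype _))) ?_
  rintro ⟨g, hgu⟩
  change (logDerivSingle D g).coeff l = 0 ↔ g ∈ _
  by_cases hg : g = 0
  · simp only [hg, map_zero, coeff_zero, zero_mem]
  rw [mem_upper_psiValuation hψ hg] at hgu
  rw [mem_lower_psiValuation hψ hg]
  refine ⟨fun h0 => lt_of_le_of_ne hgu fun heq => ?_, fun hlt => ?_⟩
  · exact coeff_orderTop_ne ((orderTop_logDerivSingle hD hg).trans (by rw [heq])) h0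
  · apply coeff_eq_zero_of_lt_orderTop
    rw [orderTop_logDerivSingle hD hg]
    exact WithTop.coe_lt_coe.2 hlt

end PowerSeries

/-! ### H-fields -/

section LexOrder

variable {G k : Type*} [AddCommGroup G] [LinearOrder G] [Field k] [LinearOrder k]
  [IsStrictOrderedRing k]

theorem lt_of_orderTop_neg {a b : Lex k⟦G⟧} (ha : 0 < a) (hav : (ofLex a).orderTop < 0)
    (hb : 0 ≤ (ofLex b).orderTop) : b < a := by
  have h := abs_lt_abs_of_orderTop_ofLex (x := b) (y := a) (hav.trans_le hb)
  rw [abs_of_pos ha] at h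
  exact (le_abs_self b).trans_lt h

theorem orderTop_nonneg_of_abs_le {a b : Lex k⟦G⟧} (hb : 0 ≤ (ofLex b).orderTop) (hab : |a| ≤ b) :
    0 ≤ (ofLex a).orderTop := by
  by_contra! hlt
  have h := abs_lt_abs_of_orderTop_ofLex (x := b) (y := a) (hlt.trans_le hb)
  exact absurd (hab.trans (le_abs_self b)) h.not_ge

end LexOrder

section Ordered

variable {G k : Type*} [AddCommGroup G] [LinearOrder G] [IsOrderedAddMonoid G] [Field k]
  {ψ : {g : G // g ≠ 0} → G}

/-- A derivation of `k((G))`, as a derivation of the ordered field `k((G))`. -/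
noncomputable def lexDerivation (D : Derivation ℤ k⟦G⟧ k⟦G⟧) :
    Derivation ℤ (Lex k⟦G⟧) (Lex k⟦G⟧) :=
  Derivation.mk'
    (AddMonoidHom.toIntLinearMap <|
      AddMonoidHom.mk' (fun a : Lex k⟦G⟧ => toLex (D (ofLex a))) fun _ _ => D.map_add _ _)
    fun a b => D.leibniz (ofLex a) (ofLex b)

theorem ofLex_lexDerivation (D : Derivation ℤ k⟦G⟧ k⟦G⟧) (a : Lex k⟦G⟧) :
    ofLex (lexDerivation D a) = D (ofLex a) :=
  rfl

/-- A derivation of the ordered field `k((G))`, as a derivation of `k((G))`. -/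
noncomputable def unlexDerivation (D : Derivation ℤ (Lex k⟦G⟧) (Lex k⟦G⟧)) :
    Derivation ℤ k⟦G⟧ k⟦G⟧ :=
  Derivation.mk'
    (AddMonoidHom.toIntLinearMap <|
      AddMonoidHom.mk' (fun a : k⟦G⟧ => ofLex (D (toLex a))) fun _ _ => D.map_add _ _)
    fun a b => D.leibniz (toLex a) (toLex b)

theorem hasAsymptoticCouple_unlexDerivation {D : Derivation ℤ (Lex k⟦G⟧) (Lex k⟦G⟧)}
    (hD : HasAsymptoticCouple (lexAddVal G k) D ψ) :
    HasAsymptoticCouple (addVal G k) (unlexDerivation D) ψ :=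
  ⟨hD.1, fun g a ha => hD.2 g (toLex a) ha⟩

theorem hasAsymptoticCouple_lexDerivation {χ : Set.range ψ → G →+ k}
    (hψ : IsHTypeAsymptoticCouple ψ) (hχ : IsPsiFamily ψ χ) :
    HasAsymptoticCouple (lexAddVal G k) (lexDerivation (hχ.derivation hψ)) ψ :=
  hasAsymptoticCouple_of_valuation_eq (addVal_surjective (G := G) (k := k))
    fun _ _ hg ha => hχ.orderTop_derivation hψ hg ha

variable [LinearOrder k] [IsStrictOrderedRing k]

/-- An element a above the valuation ring has v(a) = g < 0 and positive leading coefficient; that of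
D a is its product with χ_{ψ(g)}(g), which `hpos` makes positive. -/
theorem isHField_of_isPsiFamily {χ : Set.range ψ → G →+ k} (hψ : IsHTypeAsymptoticCouple ψ)
    (hχ : IsPsiFamily ψ χ)
    (hpos : ∀ (g : G) (hg : g < 0), 0 < χ ⟨ψ ⟨g, hg.ne⟩, ⟨g, hg.ne⟩, rfl⟩ g) :
    IsHField (lexAddVal G k) (lexDerivation (hχ.derivation hψ)) := by
  have hD : ∀ (a : Lex k⟦G⟧) (g : G) (hg : g ≠ 0), lexAddVal G k a = g →
      lexAddVal G k (lexDerivation (hχ.derivation hψ) a) = (g + ψ ⟨g, hg⟩ : G) :=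
    fun a g hg ha => hχ.orderTop_derivation hψ hg ha
  have hdecomp : ∀ a : Lex k⟦G⟧, 0 ≤ lexAddVal G k a → ∃ ε c : Lex k⟦G⟧,
      0 < lexAddVal G k ε ∧ lexDerivation (hχ.derivation hψ) c = 0 ∧ a = ε + c := by
    intro a ha
    obtain ⟨ε, hε, h⟩ := exists_eq_add_single_zero (ofLex a) ha
    exact ⟨toLex ε, toLex (single 0 ((ofLex a).coeff 0)), hε, hχ.derivation_C hψ _, h⟩
  have hdv := isDifferentialValued_of_valuation_eq hψ.toIsAsymptoticCouple hD hdecomp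
  refine { hdv.toIsPreDifferentialValued with ph2 := ⟨?_⟩, ph3 := ?_, h1 := ?_, h2 := ?_ }
  · intro a ha b hb c hc
    have hmax : 0 ≤ (ofLex (max |a| |b|)).orderTop := by
      rcases max_choice |a| |b| with h | h <;> rw [h, orderTop_abs]
      · exact ha
      · exact hb
    exact orderTop_nonneg_of_abs_le hmax (abs_le_max_abs_abs hc.1 hc.2)
  · intro a ha
    have hapos : 0 < a := ha 0 (by rw [AddValuation.map_zero]; exact le_top)
    have hav : (ofLex a).orderTop < 0 := by
      by_contra! h
      exact lt_irrefl _ (ha a h)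
    obtain ⟨g, hg⟩ := WithTop.ne_top_iff_exists.1 hav.ne_top
    have hg0 : g < 0 := by
      rw [← hg] at hav
      exact WithTop.coe_lt_coe.1 hav
    rw [← leadingCoeff_pos_iff, ofLex_lexDerivation,
      hχ.leadingCoeff_derivation hψ hg0.ne hg.symm]
    exact mul_pos (leadingCoeff_pos_iff.2 hapos) (hpos g hg0)
  · intro a
    refine ⟨fun ha => ?_, ?_⟩
    -- Adding 1 absorbs a possibly positive infinitesimal part of |a|.
    · refine ⟨toLex (single 0 ((ofLex |a|).coeff 0 + 1)), hχ.derivation_C hψ _, le_of_lt ?_⟩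
      rw [lt_iff]
      refine ⟨0, fun j hj => ?_, ?_⟩
      · rw [ofLex_toLex, coeff_single_of_ne hj.ne]
        refine coeff_eq_zero_of_lt_orderTop ?_
        rw [orderTop_abs]
        exact lt_of_lt_of_le (WithTop.coe_lt_coe.2 hj) ha
      · rw [ofLex_toLex, coeff_single_same]
        exact lt_add_one _
    · rintro ⟨c, hc, hac⟩
      exact orderTop_nonneg_of_abs_le (valuation_nonneg_of_const hD hc) hac
  · intro a
    rw [hdv.dv1]
    constructor
    · rintro ⟨ε, c, hε, hc, rfl⟩
      exact ⟨c, ε, hc, hε, add_comm _ _⟩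
    · rintro ⟨c, ε, hc, hε, rfl⟩
      exact ⟨ε, c, hε, hc, add_comm _ _⟩

/-- In an H-field `k((G))` the logarithmic derivative of an infinitesimal `t^g` is negative. -/
theorem coeff_logDerivSingle_neg {D : Derivation ℤ (Lex k⟦G⟧) (Lex k⟦G⟧)}
    (hH : IsHField (lexAddVal G k) D) (hD : HasAsymptoticCouple (lexAddVal G k) D ψ) {g : G}
    (hg : 0 < g) : (logDerivSingle (unlexDerivation D) g).coeff (ψ ⟨g, hg.ne'⟩) < 0 := by
  have hD' := hasAsymptoticCouple_unlexDerivation hD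
  -- The H-field axiom speaks of elements above the valuation ring, hence the passage to t^(-g);
  -- additivity of the logarithmic derivative then flips the sign.
  have hord : (single (-g) (1 : k)).orderTop = (-g : G) := orderTop_single one_ne_zero
  have htpos : (0 : Lex k⟦G⟧) < toLex (single (-g) (1 : k)) := by
    rw [← leadingCoeff_pos_iff, ofLex_toLex, leadingCoeff_of_single]
    exact one_pos
  have h1 : 0 < D (toLex (single (-g) (1 : k))) := by
    refine hH.ph3 _ fun b hb => lt_of_orderTop_neg htpos ?_ hb
    rw [ofLex_toLex, hord]
    exact WithTop.coe_lt_coe.2 (neg_lt_zero.2 hg)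
  have h2 : logDerivSingle (unlexDerivation D) (-g) * single (-g) 1 =
      ofLex (D (toLex (single (-g) (1 : k)))) :=
    div_mul_cancel₀ _ (single_ne_zero one_ne_zero)
  rw [← leadingCoeff_pos_iff, ← h2, leadingCoeff_mul, leadingCoeff_of_single, mul_one, map_neg,
    leadingCoeff_neg] at h1
  have h3 := orderTop_logDerivSingle hD' hg.ne'
  rw [← coeff_untop_eq_leadingCoeff (hx := by rw [h3]; exact WithTop.coe_ne_top)] at h1
  simp only [h3, WithTop.untop_coe] at h1
  exact neg_pos.1 h1

end Ordered

/-! ### The main theorem. -/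

theorem mainTheorem6 {G : Type*} [AddCommGroup G] [LinearOrder G] [IsOrderedAddMonoid G]
    (k : Type*) [Field k]
    (ψ : {g : G // g ≠ 0} → G) (hψ : IsHTypeAsymptoticCouple ψ) :
    -- fields
    (((∃ D : Derivation ℤ k⟦G⟧ k⟦G⟧,
          IsDifferentialValued (addVal G k) D ∧ HasAsymptoticCouple (addVal G k) D ψ) ↔
        ∀ l, ∃ u : (psiValuation hψ.toIsAsymptoticCouple).Component l →+ k,
          Function.Injective u) ∧
      ∀ u : ∀ l, (psiValuation hψ.toIsAsymptoticCouple).Component l →+ k,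
        (∀ l, Function.Injective (u l)) →
        (∃ ι, IsHahnEmbedding (psiValuation hψ.toIsAsymptoticCouple) ι) ∧
        ∃ u' : ∀ l, DivisibleHull ((psiValuation hψ.toIsAsymptoticCouple).Component l) →+ k,
          (∀ l b, u' l (DivisibleHull.coe b) = u l b) ∧
          ∀ ι, IsHahnEmbedding (psiValuation hψ.toIsAsymptoticCouple) ι →
            ∃ D : Derivation ℤ k⟦G⟧ k⟦G⟧,
              IsGivenByFormula hψ.toIsAsymptoticCouple ι u' D ∧
              IsDifferentialValued (addVal G k) D ∧ HasAsymptoticCouple (addVal G k) D ψ) ∧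
    -- ordered fields
    (∀ [LinearOrder k] [IsStrictOrderedRing k],
      ((∃ D : Derivation ℤ (Lex k⟦G⟧) (Lex k⟦G⟧),
          IsHField (lexAddVal G k) D ∧ HasAsymptoticCouple (lexAddVal G k) D ψ) ↔
        ∀ l, ∃ u : (psiValuation hψ.toIsAsymptoticCouple).Component l →+ k,
          Function.Injective u ∧
          ∀ b c, (psiValuation hψ.toIsAsymptoticCouple).componentLE l b c ↔ u b ≤ u c) ∧
      ∀ u : ∀ l, (psiValuation hψ.toIsAsymptoticCouple).Component l →+ k,
        (∀ l, Function.Injective (u l) ∧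
          ∀ b c, (psiValuation hψ.toIsAsymptoticCouple).componentLE l b c ↔ u l c ≤ u l b) →
        (∃ ι, IsHahnEmbedding (psiValuation hψ.toIsAsymptoticCouple) ι) ∧
        ∃ u' : ∀ l, DivisibleHull ((psiValuation hψ.toIsAsymptoticCouple).Component l) →+ k,
          (∀ l b, u' l (DivisibleHull.coe b) = u l b) ∧
          ∀ ι, IsHahnEmbedding (psiValuation hψ.toIsAsymptoticCouple) ι →
            ∃ D : Derivation ℤ (Lex k⟦G⟧) (Lex k⟦G⟧),
              IsGivenByFormula hψ.toIsAsymptoticCouple ι u' (fun a => ofLex (D (toLex a))) ∧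
              IsHField (lexAddVal G k) D ∧ HasAsymptoticCouple (lexAddVal G k) D ψ) := by
  have field_part : ∀ u : ∀ l, (psiValuation hψ.toIsAsymptoticCouple).Component l →+ k,
      (∀ l, Function.Injective (u l)) →
      (∃ ι, IsHahnEmbedding (psiValuation hψ.toIsAsymptoticCouple) ι) ∧
      ∃ u' : ∀ l, DivisibleHull ((psiValuation hψ.toIsAsymptoticCouple).Component l) →+ k,
        (∀ l b, u' l (DivisibleHull.coe b) = u l b) ∧
        ∀ ι, IsHahnEmbedding (psiValuation hψ.toIsAsymptoticCouple) ι →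
          ∃ D : Derivation ℤ k⟦G⟧ k⟦G⟧,
            IsGivenByFormula hψ.toIsAsymptoticCouple ι u' D ∧
            IsDifferentialValued (addVal G k) D ∧ HasAsymptoticCouple (addVal G k) D ψ := by
    intro u hu
    obtain ⟨u', hu'⟩ := exists_divisibleHull_extension hψ.toIsAsymptoticCouple u hu
    refine ⟨exists_isHahnEmbedding hψ, u', hu', fun ι hι => ?_⟩
    have hχ := isPsiFamily_hahnCharacter hι hu' hu
    exact ⟨hχ.derivation hψ, isGivenByFormula_derivation hψ hχ, hχ.isDifferentialValued hψ,
      hχ.hasAsymptoticCouple hψ⟩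
  refine ⟨⟨⟨?_, fun h => ?_⟩, field_part⟩, ?_⟩
  · rintro ⟨D, -, hD⟩ l
    obtain ⟨u, hu, -⟩ := exists_component_embedding_logDerivSingle hψ.toIsAsymptoticCouple hD l
    exact ⟨u, hu⟩
  · choose u hu using h
    obtain ⟨⟨ι, hι⟩, u', -, h⟩ := field_part u hu
    obtain ⟨D, -, hD⟩ := h ι hι
    exact ⟨D, hD⟩
  intro _ _
  have ordered_part : ∀ u : ∀ l, (psiValuation hψ.toIsAsymptoticCouple).Component l →+ k,
      (∀ l, Function.Injective (u l) ∧
        ∀ b c, (psiValuation hψ.toIsAsymptoticCouple).componentLE l b c ↔ u l c ≤ u l b) →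
      (∃ ι, IsHahnEmbedding (psiValuation hψ.toIsAsymptoticCouple) ι) ∧
      ∃ u' : ∀ l, DivisibleHull ((psiValuation hψ.toIsAsymptoticCouple).Component l) →+ k,
        (∀ l b, u' l (DivisibleHull.coe b) = u l b) ∧
        ∀ ι, IsHahnEmbedding (psiValuation hψ.toIsAsymptoticCouple) ι →
          ∃ D : Derivation ℤ (Lex k⟦G⟧) (Lex k⟦G⟧),
            IsGivenByFormula hψ.toIsAsymptoticCouple ι u' (fun a => ofLex (D (toLex a))) ∧
            IsHField (lexAddVal G k) D ∧ HasAsymptoticCouple (lexAddVal G k) D ψ := by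
    intro u hu
    obtain ⟨u', hu'⟩ := exists_divisibleHull_extension hψ.toIsAsymptoticCouple u fun l => (hu l).1
    refine ⟨exists_isHahnEmbedding hψ, u', hu', fun ι hι => ?_⟩
    have hχ := isPsiFamily_hahnCharacter hι hu' fun l => (hu l).1
    refine ⟨lexDerivation (hχ.derivation hψ), isGivenByFormula_derivation hψ hχ,
      isHField_of_isPsiFamily hψ hχ fun g hg => ?_, hasAsymptoticCouple_lexDerivation hψ hχ⟩
    have hgu : g ∈ (psiValuation hψ.toIsAsymptoticCouple).upper ⟨ψ ⟨g, hg.ne⟩, ⟨g, hg.ne⟩, rfl⟩ :=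
      (mem_upper_psiValuation _ hg.ne).2 le_rfl
    refine lt_of_lt_of_eq (pos_of_componentLE_iff _ _ (hu _).1 (hu _).2 ⟨g, hgu⟩ hg ?_)
      (hahnCharacter_apply_upper hι hu' _ ⟨g, hgu⟩).symm
    rw [mem_lower_psiValuation _ hg.ne]
    exact lt_irrefl _
  refine ⟨⟨?_, fun h => ?_⟩, ordered_part⟩
  · rintro ⟨D, hH, hD⟩ l
    obtain ⟨u, hu, hcoeff⟩ := exists_component_embedding_logDerivSingle hψ.toIsAsymptoticCouple
      (hasAsymptoticCouple_unlexDerivation hD) l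
    have hle := componentLE_iff_of_neg hψ.toIsAsymptoticCouple u hu fun g hg hgl => by
      have h1 := (psiValuation_eq_coe_iff _ hg.ne' l).1
        (GroupValuation.eq_coe_of_mem_upper_of_notMem_lower _ g.2 hgl)
      rw [hcoeff, ← h1]
      exact coeff_logDerivSingle_neg hH hD hg
    -- The coefficient of the logarithmic derivative reverses the order, so its negative is the
    -- ordered embedding sought. The converse direction changes sign in the same way.
    refine ⟨-u, fun b c hbc => hu (neg_injective hbc), fun b c => ?_⟩
    rw [hle, AddMonoidHom.neg_apply, AddMonoidHom.neg_apply, neg_le_neg_iff]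
  · choose u hu hle using h
    obtain ⟨⟨ι, hι⟩, u', -, h⟩ := ordered_part (fun l => -u l) fun l =>
      ⟨fun b c hbc => hu l (neg_injective hbc), fun b c => by
        rw [hle, AddMonoidHom.neg_apply, AddMonoidHom.neg_apply, neg_le_neg_iff]⟩
    obtain ⟨D, -, hD⟩ := h ι hι
    exact ⟨D, hD⟩
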